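/- Let $S^\infty$ denote the unit sphere of the real Hilbert space $\ell^2$, with inner product $\cdot$ and endowed with its geodesic distance $(x,y)\mapsto\arccos(x\cdot y)$. Let $K$ be a continuous real kernel on $S^\infty\times S^\infty$ (that is, a continuous real function on $(S^\infty\times S^\infty)^2$) which is isotropic: there is a real function $f$ on $[-1,1]^2$, called the isotropic part of $K$, such that $$K((x,z),(y,w))=f(x\cdot y,\,z\cdot w),\qquad x,y,z,w\in S^\infty .$$ Then $K$ is positive definite, i.e. $\sum_{\mu,\nu=1}^n c_\mu c_\nu K(p_\mu,p_\nu)\ge 0$ for all $n\ge 1$, all distinct points $p_1,\dots,p_n\in S^\infty\times S^\infty$ and all real numbers $c_1,\dots,c_n$, if and only if $f$ has a representation of the form $$f(t,s)=\sum_{k,l=0}^{\infty} f_{k,l}\,t^k s^l,\qquad t,s\in[-1,1],$$ in which $f_{k,l}\ge 0$ for all integers $k,l\ge 0$ and $\sum_{k,l=0}^\infty f_{k,l}<\infty$ (with the convention $0^0=1$). -/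

import Mathlib

/-- The real Hilbert sphere: the unit sphere of the real sequence space `ℓ²`. -/
abbrev HilbertSphere : Type :=
  Metric.sphere (0 : lp (fun _ : ℕ => ℝ) 2) 1

/-- The inner product of two points of the Hilbert sphere. -/
noncomputable def HilbertSphere.dot (x y : HilbertSphere) : ℝ :=
  inner ℝ (x : lp (fun _ : ℕ => ℝ) 2) (y : lp (fun _ : ℕ => ℝ) 2)

/-- The geodesic distance on the Hilbert sphere. -/
noncomputable def HilbertSphere.geodesicDist (x y : HilbertSphere) : ℝ :=
  Real.arccos (HilbertSphere.dot x y)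

/-- A real kernel `K` on a set `X` is positive definite if
`∑ μ, ∑ ν, c μ * c ν * K (x μ) (x ν) ≥ 0` for all `n ≥ 1`, all distinct points
`x 1, …, x n` of `X` and all real scalars `c 1, …, c n`. -/
def IsPositiveDefiniteKernel {X : Type*} (K : X → X → ℝ) : Prop :=
  ∀ n : ℕ, 1 ≤ n → ∀ x : Fin n → X, Function.Injective x → ∀ c : Fin n → ℝ,
    0 ≤ ∑ μ, ∑ ν, c μ * c ν * K (x μ) (x ν)

/-- `f` is the isotropic part of the kernel `K`:
`K ((x, z), (y, w)) = f (x · y, z · w)`. Only the values of `f` on `[-1, 1]²` matter. -/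
def IsIsotropicPart
    (K : HilbertSphere × HilbertSphere → HilbertSphere × HilbertSphere → ℝ)
    (f : ℝ → ℝ → ℝ) : Prop :=
  ∀ x y z w : HilbertSphere,
    K (x, z) (y, w) = f (HilbertSphere.dot x y) (HilbertSphere.dot z w)

/-- Joint continuity of a kernel, each sphere being endowed with the geodesic distance. -/
def IsContinuousKernel
    (K : HilbertSphere × HilbertSphere → HilbertSphere × HilbertSphere → ℝ) : Prop :=
  ∀ p q : HilbertSphere × HilbertSphere, ∀ ε > 0, ∃ δ > 0,
    ∀ p' q' : HilbertSphere × HilbertSphere,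
      HilbertSphere.geodesicDist p'.1 p.1 < δ → HilbertSphere.geodesicDist p'.2 p.2 < δ →
      HilbertSphere.geodesicDist q'.1 q.1 < δ → HilbertSphere.geodesicDist q'.2 q.2 < δ →
      |K p' q' - K p q| < ε

/-! The cube `{±1/√d}^d` is inscribed in the sphere, and the inner product of two vertices is the
mean of the product of their sign vectors. So on a product of two cubes `K` is a
translation-invariant kernel on a finite group of signs, and testing it on characters shows that its
Fourier coefficients are nonnegative (`sum_signChar_nonneg`). The Bernstein polynomial of `f` at
`(t, s)` is the expectation of `f` at the means of `d` independent signs of expectation `t` and `d`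
of expectation `s`. Expanding the probabilities in characters (`signWeight_eq_sum`) makes its
monomial coefficients sums of those Fourier coefficients, hence nonnegative. These polynomials
converge to `f` by the weak law of large numbers (`tendsto_signBernstein`), and
`hasSum_limit_of_nonneg_coeff` carries the expansion to the limit. The converse is the Schur product
theorem, applied monomial by monomial. -/

open Finset Filter Topology

/-! ### Random signs and their moments -/

/-- The mean of a vector of signs. -/
noncomputable def signMean {d : ℕ} (σ : Fin d → ℤˣ) : ℝ := (∑ i, ((σ i : ℤ) : ℝ)) / d

/-- The character of the sign group attached to a set of coordinates. -/
noncomputable def signChar {d : ℕ} (A : Finset (Fin d)) (σ : Fin d → ℤˣ) : ℝ :=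
  ∏ i ∈ A, ((σ i : ℤ) : ℝ)

/-- The probability of a vector of independent signs, each of expectation `t`. -/
noncomputable def signWeight {d : ℕ} (t : ℝ) (σ : Fin d → ℤˣ) : ℝ :=
  ∏ i, (1 + ((σ i : ℤ) : ℝ) * t) / 2

theorem sum_intUnits {M : Type*} [AddCommMonoid M] (g : ℤˣ → M) : ∑ u, g u = g 1 + g (-1) := by
  rw [show (univ : Finset ℤˣ) = {1, -1} from rfl, sum_pair (by decide)]

theorem intUnits_cast_eq (u : ℤˣ) : ((u : ℤ) : ℝ) = 1 ∨ ((u : ℤ) : ℝ) = -1 := by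
  rcases Int.units_eq_one_or u with rfl | rfl <;> simp

theorem signChar_mul {d : ℕ} (A : Finset (Fin d)) (σ τ : Fin d → ℤˣ) :
    signChar A (σ * τ) = signChar A σ * signChar A τ := by
  simp [signChar, prod_mul_distrib]

theorem signMean_mem_Icc {d : ℕ} (σ : Fin d → ℤˣ) : signMean σ ∈ Set.Icc (-1 : ℝ) 1 := by
  rw [Set.mem_Icc, ← abs_le, signMean, abs_div, Nat.abs_cast]
  refine div_le_one_of_le₀ ((abs_sum_le_sum_abs _ _).trans ?_) (Nat.cast_nonneg d)
  have h : ∀ i, |((σ i : ℤ) : ℝ)| = 1 := fun i => by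
    rcases intUnits_cast_eq (σ i) with h | h <;> simp [h]
  simp [h]

theorem signWeight_nonneg {d : ℕ} {t : ℝ} (ht : t ∈ Set.Icc (-1 : ℝ) 1) (σ : Fin d → ℤˣ) :
    0 ≤ signWeight t σ := by
  refine prod_nonneg fun i _ => ?_
  rcases intUnits_cast_eq (σ i) with h | h <;> rw [h] <;> linarith [ht.1, ht.2]

/-- Independence: a sign is `1` with probability `(1 + t) / 2`, and expectations of products factor.
All the moments below are instances. -/
theorem sum_signWeight_mul_prod {d : ℕ} (t : ℝ) (g : Fin d → ℤˣ → ℝ) :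
    ∑ σ, signWeight t σ * ∏ i, g i (σ i) =
      ∏ i, ((1 + t) / 2 * g i 1 + (1 - t) / 2 * g i (-1)) := by
  simp only [signWeight, ← prod_mul_distrib]
  rw [← Fintype.piFinset_univ,
    sum_prod_piFinset univ (fun i (u : ℤˣ) => (1 + ((u : ℤ) : ℝ) * t) / 2 * g i u)]
  refine prod_congr rfl fun i _ => ?_
  rw [sum_intUnits]
  simp [sub_eq_add_neg]

theorem sum_signWeight (d : ℕ) (t : ℝ) : ∑ σ : Fin d → ℤˣ, signWeight t σ = 1 := by
  have h := sum_signWeight_mul_prod (d := d) t (fun _ _ => 1)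
  simp only [prod_const_one, mul_one] at h
  rw [h]
  exact prod_eq_one fun _ _ => by ring

theorem sum_signWeight_mul_covariance {d : ℕ} (t : ℝ) (j k : Fin d) :
    ∑ σ : Fin d → ℤˣ, signWeight t σ * ((((σ j : ℤ) : ℝ) - t) * (((σ k : ℤ) : ℝ) - t)) =
      if j = k then 1 - t ^ 2 else 0 := by
  have h := sum_signWeight_mul_prod (d := d) t
    (fun i u => (if i = j then ((u : ℤ) : ℝ) - t else 1) * (if i = k then ((u : ℤ) : ℝ) - t else 1))
  simp only [prod_mul_distrib, prod_ite_eq', mem_univ, if_true] at h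
  rw [h]
  split_ifs with hjk
  · subst hjk
    rw [prod_eq_single j]
    · simp; ring
    · intro i _ hi
      simp [hi]; ring
    · simp
  · refine prod_eq_zero (mem_univ j) ?_
    simp [hjk]; ring

theorem sum_signWeight_mul_sq {d : ℕ} (hd : d ≠ 0) (t : ℝ) :
    ∑ σ : Fin d → ℤˣ, signWeight t σ * (signMean σ - t) ^ 2 = (1 - t ^ 2) / d := by
  have hd' : (d : ℝ) ≠ 0 := Nat.cast_ne_zero.mpr hd
  have h : ∀ σ : Fin d → ℤˣ, signWeight t σ * (signMean σ - t) ^ 2 =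
      (∑ j, ∑ k, signWeight t σ * ((((σ j : ℤ) : ℝ) - t) * (((σ k : ℤ) : ℝ) - t))) / d ^ 2 := by
    intro σ
    have hm : signMean σ - t = (∑ j, (((σ j : ℤ) : ℝ) - t)) / d := by
      rw [sum_sub_distrib, signMean]
      simp only [sum_const, card_univ, Fintype.card_fin, nsmul_eq_mul]
      field_simp
    simp only [← mul_sum, ← sum_mul]
    rw [hm]
    ring
  simp only [h]
  rw [← sum_div, sum_comm]
  simp_rw [sum_comm (s := (univ : Finset (Fin d → ℤˣ))), sum_signWeight_mul_covariance]
  simp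
  field_simp

/-! ### Convergence of Bernstein polynomials -/

/-- The bivariate Bernstein operator on `[-1, 1]²`. -/
noncomputable def signBernstein (d : ℕ) (F : ℝ → ℝ → ℝ) (t s : ℝ) : ℝ :=
  ∑ σ : Fin d → ℤˣ, ∑ τ : Fin d → ℤˣ,
    signWeight t σ * signWeight s τ * F (signMean σ) (signMean τ)

/-- Near `(t, s)` continuity gives `ε`; at distance at least `δ` the trivial bound `2M` is absorbed
by the quadratic term. As in Chebyshev's inequality, a quadratic bound can be averaged using
variances alone. -/
theorem exists_quadratic_modulus {F : ℝ → ℝ → ℝ}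
    (hF : ContinuousOn (Function.uncurry F) (Set.Icc (-1) 1 ×ˢ Set.Icc (-1) 1))
    {t s : ℝ} (ht : t ∈ Set.Icc (-1 : ℝ) 1) (hs : s ∈ Set.Icc (-1 : ℝ) 1) {ε : ℝ} (hε : 0 < ε) :
    ∃ C, 0 ≤ C ∧ ∀ u ∈ Set.Icc (-1 : ℝ) 1, ∀ v ∈ Set.Icc (-1 : ℝ) 1,
      |F u v - F t s| ≤ ε + C * ((u - t) ^ 2 + (v - s) ^ 2) := by
  obtain ⟨M, hM⟩ := (isCompact_Icc.prod isCompact_Icc).exists_bound_of_continuousOn hF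
  obtain ⟨δ, hδ, hc⟩ := Metric.continuousOn_iff.mp hF (t, s) ⟨ht, hs⟩ ε hε
  have hM' : ∀ u ∈ Set.Icc (-1 : ℝ) 1, ∀ v ∈ Set.Icc (-1 : ℝ) 1, |F u v| ≤ M :=
    fun u hu v hv => hM (u, v) ⟨hu, hv⟩
  have hM0 : 0 ≤ M := (abs_nonneg _).trans (hM' t ht s hs)
  refine ⟨2 * M / δ ^ 2, by positivity, fun u hu v hv => ?_⟩
  by_cases h : dist (u, v) (t, s) < δ
  · have := hc (u, v) ⟨hu, hv⟩ h
    rw [Real.dist_eq] at this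
    have h2 : 0 ≤ 2 * M / δ ^ 2 * ((u - t) ^ 2 + (v - s) ^ 2) := by positivity
    simp only [Function.uncurry_apply_pair] at this
    linarith
  · have h1 : δ ^ 2 ≤ (u - t) ^ 2 + (v - s) ^ 2 := by
      rw [not_lt, Prod.dist_eq, le_max_iff, Real.dist_eq, Real.dist_eq] at h
      rcases h with h | h
      · have := pow_le_pow_left₀ hδ.le h 2
        rw [sq_abs] at this
        linarith [sq_nonneg (v - s)]
      · have := pow_le_pow_left₀ hδ.le h 2
        rw [sq_abs] at this
        linarith [sq_nonneg (u - t)]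
    have h2 : 2 * M ≤ 2 * M / δ ^ 2 * ((u - t) ^ 2 + (v - s) ^ 2) := by
      calc 2 * M = 2 * M / δ ^ 2 * δ ^ 2 := by field_simp
        _ ≤ _ := by gcongr
    have h3 : |F u v - F t s| ≤ |F u v| + |F t s| := abs_sub _ _
    linarith [hM' u hu v hv, hM' t ht s hs]

theorem abs_signBernstein_sub_le {F : ℝ → ℝ → ℝ} {t s ε C : ℝ}
    (ht : t ∈ Set.Icc (-1 : ℝ) 1) (hs : s ∈ Set.Icc (-1 : ℝ) 1) (hC : 0 ≤ C)
    (h : ∀ u ∈ Set.Icc (-1 : ℝ) 1, ∀ v ∈ Set.Icc (-1 : ℝ) 1,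
      |F u v - F t s| ≤ ε + C * ((u - t) ^ 2 + (v - s) ^ 2)) {d : ℕ} (hd : d ≠ 0) :
    |signBernstein d F t s - F t s| ≤ ε + C * (2 / d) := by
  have hone : ∑ σ : Fin d → ℤˣ, ∑ τ : Fin d → ℤˣ, signWeight t σ * signWeight s τ = 1 := by
    rw [← sum_mul_sum, sum_signWeight, sum_signWeight, one_mul]
  have h1 : signBernstein d F t s - F t s = ∑ σ : Fin d → ℤˣ, ∑ τ : Fin d → ℤˣ,
      signWeight t σ * signWeight s τ * (F (signMean σ) (signMean τ) - F t s) := by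
    simp only [mul_sub, sum_sub_distrib, ← sum_mul, hone, one_mul]
    rfl
  have h2 : ∑ σ : Fin d → ℤˣ, ∑ τ : Fin d → ℤˣ, signWeight t σ * signWeight s τ *
      (ε + C * ((signMean σ - t) ^ 2 + (signMean τ - s) ^ 2)) =
      ε + C * ((1 - t ^ 2) / d + (1 - s ^ 2) / d) := by
    have e : ∀ σ τ : Fin d → ℤˣ, signWeight t σ * signWeight s τ *
      (ε + C * ((signMean σ - t) ^ 2 + (signMean τ - s) ^ 2)) =
        ε * (signWeight t σ * signWeight s τ) +
        C * ((signWeight t σ * (signMean σ - t) ^ 2) * signWeight s τ +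
          signWeight t σ * (signWeight s τ * (signMean τ - s) ^ 2)) := fun σ τ => by ring
    simp only [e, sum_add_distrib, ← mul_sum, ← sum_mul, sum_signWeight, sum_signWeight_mul_sq hd]
    ring
  rw [h1]
  calc _ ≤ ∑ σ : Fin d → ℤˣ, ∑ τ : Fin d → ℤˣ, signWeight t σ * signWeight s τ *
      (ε + C * ((signMean σ - t) ^ 2 + (signMean τ - s) ^ 2)) := by
        refine (abs_sum_le_sum_abs _ _).trans (sum_le_sum fun σ _ => ?_)
        refine (abs_sum_le_sum_abs _ _).trans (sum_le_sum fun τ _ => ?_)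
        have hw := mul_nonneg (signWeight_nonneg ht σ) (signWeight_nonneg hs τ)
        rw [abs_mul, abs_of_nonneg hw]
        exact mul_le_mul_of_nonneg_left (h _ (signMean_mem_Icc σ) _ (signMean_mem_Icc τ)) hw
    _ = ε + C * ((1 - t ^ 2) / d + (1 - s ^ 2) / d) := h2
    _ ≤ ε + C * (2 / d) := by
        rw [← add_div]
        gcongr
        nlinarith [sq_nonneg t, sq_nonneg s]

theorem tendsto_signBernstein {F : ℝ → ℝ → ℝ}
    (hF : ContinuousOn (Function.uncurry F) (Set.Icc (-1) 1 ×ˢ Set.Icc (-1) 1))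
    {t s : ℝ} (ht : t ∈ Set.Icc (-1 : ℝ) 1) (hs : s ∈ Set.Icc (-1 : ℝ) 1) :
    Tendsto (fun d => signBernstein d F t s) atTop (𝓝 (F t s)) := by
  -- The primed form asks only for `d > N`, which excludes `d = 0`.
  rw [Metric.tendsto_atTop']
  intro ε hε
  obtain ⟨C, hC, h⟩ := exists_quadratic_modulus hF ht hs (half_pos hε)
  have hlim : Tendsto (fun d : ℕ => C * (2 / (d : ℝ))) atTop (𝓝 0) := by
    simpa using (tendsto_const_div_atTop_nhds_zero_nat (2 : ℝ)).const_mul C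
  obtain ⟨N, hN⟩ := eventually_atTop.mp (hlim.eventually_lt_const (half_pos hε))
  refine ⟨N, fun d hd => ?_⟩
  rw [Real.dist_eq]
  have h1 := abs_signBernstein_sub_le ht hs hC h (Nat.ne_zero_of_lt hd)
  have h2 := hN d hd.le
  linarith

/-! ### Monomial expansion of Bernstein polynomials -/

theorem signWeight_eq_sum {d : ℕ} (t : ℝ) (σ : Fin d → ℤˣ) :
    signWeight t σ = (2 ^ d)⁻¹ * ∑ A : Finset (Fin d), signChar A σ * t ^ #A := by
  rw [signWeight, prod_div_distrib, prod_one_add, powerset_univ]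
  simp [signChar, prod_mul_distrib, div_eq_inv_mul]

/-- The coefficient of the monomial of exponent `p` in the Bernstein polynomial of `F`. -/
noncomputable def signBernsteinCoeff (d : ℕ) (F : ℝ → ℝ → ℝ) (p : ℕ × ℕ) : ℝ :=
  ∑ q : Finset (Fin d) × Finset (Fin d) with (#q.1, #q.2) = p,
    (4 ^ d)⁻¹ * ∑ g : (Fin d → ℤˣ) × (Fin d → ℤˣ),
      signChar q.1 g.1 * signChar q.2 g.2 * F (signMean g.1) (signMean g.2)

theorem hasSum_signBernstein (d : ℕ) (F : ℝ → ℝ → ℝ) (t s : ℝ) :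
    HasSum (fun p : ℕ × ℕ => signBernsteinCoeff d F p * t ^ p.1 * s ^ p.2)
      (signBernstein d F t s) := by
  have hmaps : ∀ q ∈ (univ : Finset (Finset (Fin d) × Finset (Fin d))),
      (#q.1, #q.2) ∈ range (d + 1) ×ˢ range (d + 1) := fun q _ => by
    have h1 := card_le_univ q.1
    have h2 := card_le_univ q.2
    simp only [Fintype.card_fin] at h1 h2
    simp only [mem_product, mem_range]
    omega
  have hsum : signBernstein d F t s = ∑ p ∈ range (d + 1) ×ˢ range (d + 1),
      signBernsteinCoeff d F p * t ^ p.1 * s ^ p.2 := by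
    have e : ∀ p : ℕ × ℕ, signBernsteinCoeff d F p * t ^ p.1 * s ^ p.2 =
        ∑ q : Finset (Fin d) × Finset (Fin d) with (#q.1, #q.2) = p,
          (4 ^ d)⁻¹ * (∑ g : (Fin d → ℤˣ) × (Fin d → ℤˣ),
            signChar q.1 g.1 * signChar q.2 g.2 * F (signMean g.1) (signMean g.2)) *
            t ^ #q.1 * s ^ #q.2 := by
      intro p
      rw [signBernsteinCoeff, sum_mul, sum_mul]
      refine sum_congr rfl fun q hq => ?_
      rw [← (mem_filter.mp hq).2]
    simp only [e]
    rw [sum_fiberwise_of_maps_to hmaps]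
    simp only [mul_sum, sum_mul]
    rw [sum_comm, signBernstein, Fintype.sum_prod_type]
    refine sum_congr rfl fun σ _ => sum_congr rfl fun τ _ => ?_
    rw [signWeight_eq_sum, signWeight_eq_sum, mul_mul_mul_comm, sum_mul_sum, Fintype.sum_prod_type,
      mul_sum, sum_mul]
    refine sum_congr rfl fun A _ => ?_
    rw [mul_sum, sum_mul]
    refine sum_congr rfl fun B _ => ?_
    rw [← mul_inv, ← mul_pow]
    norm_num
    ring
  rw [hsum]
  -- No pair of subsets of `Fin d` has sizes outside `[0, d]²`.
  refine hasSum_sum_of_ne_finset_zero fun p hp => ?_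
  rw [signBernsteinCoeff, filter_false_of_mem, sum_empty, zero_mul, zero_mul]
  rintro q hq rfl
  exact hp (hmaps q hq)

/-! ### Limits of power series with nonnegative coefficients -/

/-- The values at `(1, 1)` are bounded and dominate all partial sums of coefficients, so a
subsequence converges coefficientwise to a summable family. -/
theorem hasSum_limit_of_nonneg_coeff {F : ℝ → ℝ → ℝ}
    (hF : ContinuousOn (Function.uncurry F) (Set.Icc (-1) 1 ×ˢ Set.Icc (-1) 1))
    {b : ℕ → ℕ × ℕ → ℝ} {P : ℕ → ℝ → ℝ → ℝ} (hb : ∀ n p, 0 ≤ b n p)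
    (hP : ∀ n t s, HasSum (fun p : ℕ × ℕ => b n p * t ^ p.1 * s ^ p.2) (P n t s))
    (hlim : ∀ t ∈ Set.Icc (-1 : ℝ) 1, ∀ s ∈ Set.Icc (-1 : ℝ) 1,
      Tendsto (fun n => P n t s) atTop (𝓝 (F t s))) :
    ∃ a : ℕ × ℕ → ℝ, (∀ p, 0 ≤ a p) ∧ Summable a ∧
      ∀ t ∈ Set.Icc (-1 : ℝ) 1, ∀ s ∈ Set.Icc (-1 : ℝ) 1,
        HasSum (fun p : ℕ × ℕ => a p * t ^ p.1 * s ^ p.2) (F t s) := by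
  have hone : ∀ n, HasSum (b n) (P n 1 1) := fun n => by simpa using hP n 1 1
  obtain ⟨C, hC⟩ := (hlim 1 (by simp) 1 (by simp)).bddAbove_range
  have hC' : ∀ n, P n 1 1 ≤ C := fun n => hC ⟨n, rfl⟩
  have hfin : ∀ n (S : Finset (ℕ × ℕ)), ∑ p ∈ S, b n p ≤ C := fun n S =>
    (sum_le_hasSum S (fun p _ => hb n p) (hone n)).trans (hC' n)
  have hbC : ∀ n p, b n p ≤ C := fun n p => by simpa using hfin n {p}
  obtain ⟨a, ha, φ, hφ, hconv⟩ :=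
    (isCompact_univ_pi fun _ : ℕ × ℕ => isCompact_Icc (a := (0 : ℝ)) (b := C)).tendsto_subseq
      (x := b) fun n p _ => ⟨hb n p, hbC n p⟩
  rw [tendsto_pi_nhds] at hconv
  have ha0 : ∀ p, 0 ≤ a p := fun p => (ha p trivial).1
  have hsum : Summable a := by
    refine summable_of_sum_le ha0 (c := C) fun S => ?_
    exact le_of_tendsto' (tendsto_finsetSum S fun p _ => hconv p) fun n => hfin _ S
  refine ⟨a, ha0, hsum, ?_⟩
  have hbd : ∀ p : ℕ × ℕ, ∀ x ∈ Set.Icc (-1 : ℝ) 1 ×ˢ Set.Icc (-1 : ℝ) 1,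
      ‖a p * x.1 ^ p.1 * x.2 ^ p.2‖ ≤ a p := by
    rintro p ⟨t, s⟩ ⟨ht, hs⟩
    rw [norm_mul, norm_mul, norm_pow, norm_pow, Real.norm_of_nonneg (ha0 p), mul_assoc]
    refine mul_le_of_le_one_right (ha0 p) ?_
    exact mul_le_one₀ (pow_le_one₀ (norm_nonneg _) (abs_le.mpr ht)) (by positivity)
      (pow_le_one₀ (norm_nonneg _) (abs_le.mpr hs))
  have hcont : ContinuousOn (fun x : ℝ × ℝ => ∑' p : ℕ × ℕ, a p * x.1 ^ p.1 * x.2 ^ p.2)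
      (Set.Icc (-1) 1 ×ˢ Set.Icc (-1) 1) :=
    continuousOn_tsum (fun p => by fun_prop) hsum hbd
  -- The dominating series `C |t|^k |s|^l` converges only in the open square; the boundary is
  -- reached afterwards by continuity of both sides.
  have hopen : Set.EqOn (fun x : ℝ × ℝ => ∑' p : ℕ × ℕ, a p * x.1 ^ p.1 * x.2 ^ p.2)
      (Function.uncurry F) (Set.Ioo (-1) 1 ×ˢ Set.Ioo (-1) 1) := by
    rintro ⟨t, s⟩ ⟨ht, hs⟩
    have h1 : Tendsto (fun n => ∑' p : ℕ × ℕ, b (φ n) p * t ^ p.1 * s ^ p.2) atTop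
        (𝓝 (∑' p : ℕ × ℕ, a p * t ^ p.1 * s ^ p.2)) := by
      have hg : Summable fun p : ℕ × ℕ => C * (|t| ^ p.1 * |s| ^ p.2) :=
        ((summable_geometric_of_lt_one (abs_nonneg t) (abs_lt.mpr ht)).mul_of_nonneg
          (summable_geometric_of_lt_one (abs_nonneg s) (abs_lt.mpr hs))
          (fun _ => by positivity) (fun _ => by positivity)).mul_left C
      refine tendsto_tsum_of_dominated_convergence hg
        (fun p => ((hconv p).mul_const _).mul_const _) (Eventually.of_forall fun n p => ?_)
      rw [norm_mul, norm_mul, norm_pow, norm_pow, Real.norm_of_nonneg (hb _ p), mul_assoc]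
      exact mul_le_mul_of_nonneg_right (hbC _ p) (by positivity)
    have h2 := (hlim t (Set.Ioo_subset_Icc_self ht) s (Set.Ioo_subset_Icc_self hs)).comp
      hφ.tendsto_atTop
    refine tendsto_nhds_unique h1 (h2.congr fun n => ?_)
    exact (hP (φ n) t s).tsum_eq.symm
  have hclosed := hopen.of_subset_closure hcont hF
    (Set.prod_mono Set.Ioo_subset_Icc_self Set.Ioo_subset_Icc_self)
    (by rw [closure_prod_eq, closure_Ioo (by norm_num)])
  intro t ht s hs
  exact (Summable.of_norm_bounded hsum fun p => hbd p (t, s) ⟨ht, hs⟩).hasSum_iff.mpr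
    (hclosed (show (t, s) ∈ _ from ⟨ht, hs⟩))

/-! ### Cubes in the Hilbert sphere and positivity of Fourier coefficients -/

theorem IsPositiveDefiniteKernel.sum_nonneg {X ι : Type*} [Fintype ι] [Nonempty ι]
    {K : X → X → ℝ} (hK : IsPositiveDefiniteKernel K) {x : ι → X} (hx : Function.Injective x)
    (c : ι → ℝ) : 0 ≤ ∑ i, ∑ j, c i * c j * K (x i) (x j) := by
  let e := (Fintype.equivFin ι).symm
  have h := hK (Fintype.card ι) Fintype.card_pos (x ∘ e) (hx.comp e.injective) (c ∘ e)
  simp only [Function.comp_apply] at h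
  rw [← e.sum_comp]
  simpa only [← e.sum_comp (fun j => c _ * c j * K (x _) (x j))] using h

theorem orthonormal_lp_single :
    Orthonormal ℝ fun i : ℕ => (lp.single 2 i (1 : ℝ) : lp (fun _ : ℕ => ℝ) 2) := by
  rw [orthonormal_iff_ite]
  intro i j
  rw [lp.inner_single_left, lp.single_apply]
  by_cases h : i = j
  · subst h; simp
  · simp [h]

/-- The vector of `ℓ²` with the given finitely many initial coordinates. -/
noncomputable def lpOfFin {d : ℕ} (v : Fin d → ℝ) : lp (fun _ : ℕ => ℝ) 2 :=
  ∑ i, v i • lp.single 2 (i : ℕ) (1 : ℝ)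

theorem inner_lpOfFin {d : ℕ} (v w : Fin d → ℝ) :
    inner ℝ (lpOfFin v) (lpOfFin w) = ∑ i, v i * w i := by
  have h := (orthonormal_lp_single.comp _ (Fin.val_injective (n := d))).inner_sum v w univ
  simpa [lpOfFin] using h

/-- The point of the Hilbert sphere with the given finitely many initial coordinates. -/
noncomputable def HilbertSphere.ofFin {d : ℕ} (v : Fin d → ℝ) (hv : ∑ i, v i * v i = 1) :
    HilbertSphere :=
  ⟨lpOfFin v, by
    rw [mem_sphere_zero_iff_norm, ← sq_eq_sq₀ (norm_nonneg _) zero_le_one,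
      ← real_inner_self_eq_norm_sq, inner_lpOfFin, hv, one_pow]⟩

theorem HilbertSphere.dot_ofFin {d : ℕ} {v w : Fin d → ℝ} (hv : ∑ i, v i * v i = 1)
    (hw : ∑ i, w i * w i = 1) :
    HilbertSphere.dot (ofFin v hv) (ofFin w hw) = ∑ i, v i * w i :=
  inner_lpOfFin v w

theorem HilbertSphere.ofFin_inj {d : ℕ} {v w : Fin d → ℝ} {hv : ∑ i, v i * v i = 1}
    {hw : ∑ i, w i * w i = 1} (h : ofFin v hv = ofFin w hw) : v = w := by
  have h1 := dot_ofFin hv hw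
  rw [← h, dot_ofFin hv hv, hv] at h1
  have h2 : ∑ i, (v i - w i) ^ 2 = 0 := by
    have : ∀ i, (v i - w i) ^ 2 = v i * v i - 2 * (v i * w i) + w i * w i := fun i => by ring
    simp only [this, sum_add_distrib, sum_sub_distrib, ← mul_sum, hv, hw, ← h1]
    norm_num
  funext i
  have := (sum_eq_zero_iff_of_nonneg fun i _ => sq_nonneg (v i - w i)).mp h2 i (mem_univ i)
  exact sub_eq_zero.mp (pow_eq_zero_iff (two_ne_zero) |>.mp this)

theorem sum_signVector_mul {d : ℕ} (σ τ : Fin d → ℤˣ) :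
    ∑ i, ((σ i : ℤ) : ℝ) / √d * (((τ i : ℤ) : ℝ) / √d) = signMean (σ * τ) := by
  simp only [div_mul_div_comm, Real.mul_self_sqrt (Nat.cast_nonneg d), ← sum_div]
  simp [signMean]

theorem signMean_mul_self {d : ℕ} [NeZero d] (σ : Fin d → ℤˣ) : signMean (σ * σ) = 1 := by
  simp [signMean]

/-- The vertex of the `d`-dimensional cube inscribed in the sphere, with the given signs. -/
noncomputable def signPoint {d : ℕ} [NeZero d] (σ : Fin d → ℤˣ) : HilbertSphere :=
  HilbertSphere.ofFin (fun i => ((σ i : ℤ) : ℝ) / √d)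
    ((sum_signVector_mul σ σ).trans (signMean_mul_self σ))

theorem dot_signPoint {d : ℕ} [NeZero d] (σ τ : Fin d → ℤˣ) :
    HilbertSphere.dot (signPoint σ) (signPoint τ) = signMean (σ * τ) :=
  (HilbertSphere.dot_ofFin _ _).trans (sum_signVector_mul σ τ)

theorem signPoint_injective {d : ℕ} [NeZero d] :
    Function.Injective (signPoint : (Fin d → ℤˣ) → HilbertSphere) := by
  intro σ τ h
  funext i
  have h1 := congrFun (HilbertSphere.ofFin_inj h) i
  have hd : √(d : ℝ) ≠ 0 := (Real.sqrt_pos.mpr (Nat.cast_pos.mpr (NeZero.pos d))).ne'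
  rw [div_left_inj' hd, Int.cast_inj] at h1
  exact Units.ext h1

theorem sum_signChar_nonneg
    {K : HilbertSphere × HilbertSphere → HilbertSphere × HilbertSphere → ℝ}
    {f : ℝ → ℝ → ℝ} (hf : IsIsotropicPart K f) (hpd : IsPositiveDefiniteKernel K)
    {d : ℕ} [NeZero d] (A B : Finset (Fin d)) :
    0 ≤ ∑ g : (Fin d → ℤˣ) × (Fin d → ℤˣ),
      signChar A g.1 * signChar B g.2 * f (signMean g.1) (signMean g.2) := by
  have h := hpd.sum_nonneg (signPoint_injective.prodMap signPoint_injective)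
    (fun g : (Fin d → ℤˣ) × (Fin d → ℤˣ) => signChar A g.1 * signChar B g.2)
  have e : ∀ g : (Fin d → ℤˣ) × (Fin d → ℤˣ), ∑ h : (Fin d → ℤˣ) × (Fin d → ℤˣ),
      signChar A g.1 * signChar B g.2 * (signChar A h.1 * signChar B h.2) *
        K (Prod.map signPoint signPoint g) (Prod.map signPoint signPoint h) =
      ∑ g : (Fin d → ℤˣ) × (Fin d → ℤˣ),
      signChar A g.1 * signChar B g.2 * f (signMean g.1) (signMean g.2) := by
    intro g
    -- Characters and inner products depend on `g * h` only, so every row of the quadratic form has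
    -- the same sum.
    refine Eq.trans ?_ (Equiv.sum_comp (Equiv.mulLeft g) _)
    refine sum_congr rfl fun h _ => ?_
    simp only [Prod.map, hf (signPoint _) (signPoint _) (signPoint _) (signPoint _), dot_signPoint, Equiv.coe_mulLeft, Prod.fst_mul, Prod.snd_mul,
      signChar_mul]
    ring
  simp only [e, sum_const, nsmul_eq_mul] at h
  exact nonneg_of_mul_nonneg_right h (Nat.cast_pos.mpr univ_nonempty.card_pos)

/-! ### Continuity of the isotropic part -/

theorem continuousOn_isotropicPart
    {K : HilbertSphere × HilbertSphere → HilbertSphere × HilbertSphere → ℝ}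
    (hK : IsContinuousKernel K) {f : ℝ → ℝ → ℝ} (hf : IsIsotropicPart K f) :
    ContinuousOn (Function.uncurry f) (Set.Icc (-1) 1 ×ˢ Set.Icc (-1) 1) := by
  have hnorm : ∀ t ∈ Set.Icc (-1 : ℝ) 1,
      ∑ i, (![t, √(1 - t ^ 2)] : Fin 2 → ℝ) i * (![t, √(1 - t ^ 2)] : Fin 2 → ℝ) i = 1 := by
    intro t ht
    have : 0 ≤ 1 - t ^ 2 := by nlinarith [ht.1, ht.2]
    simp [Fin.sum_univ_two, Real.mul_self_sqrt this]
    ring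
  -- A meridian from the pole `e`: `y t` has inner product `t` with `e`, so `f` is a slice of `K`.
  let y : Set.Icc (-1 : ℝ) 1 → HilbertSphere := fun t => HilbertSphere.ofFin _ (hnorm t t.2)
  let e : HilbertSphere := y ⟨1, by simp⟩
  have hdot : ∀ t t', HilbertSphere.dot (y t) (y t') =
      (t : ℝ) * t' + √(1 - (t : ℝ) ^ 2) * √(1 - (t' : ℝ) ^ 2) := fun t t' => by
    simp [y, HilbertSphere.dot_ofFin, Fin.sum_univ_two]
  have hself : ∀ t, HilbertSphere.geodesicDist (y t) (y t) = 0 := fun t => by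
    have := HilbertSphere.dot_ofFin (hnorm t t.2) (hnorm t t.2)
    rw [hnorm t t.2] at this
    simp only [HilbertSphere.geodesicDist, y, this, Real.arccos_one]
  have he : ∀ t s, K (e, e) (y t, y s) = f t s := fun t s => by
    simp [hf e (y t) e (y s), e, hdot]
  have hcont : ∀ t, Continuous fun t' => HilbertSphere.geodesicDist (y t') (y t) := fun t => by
    simp only [HilbertSphere.geodesicDist, hdot]
    fun_prop
  have hlim : ∀ t, Tendsto (fun t' => HilbertSphere.geodesicDist (y t') (y t)) (𝓝 t) (𝓝 0) :=
    fun t => by simpa [hself] using (hcont t).tendsto t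
  have key : Continuous fun x : Set.Icc (-1 : ℝ) 1 × Set.Icc (-1 : ℝ) 1 => f x.1 x.2 := by
    rw [continuous_iff_continuousAt]
    rintro ⟨t, s⟩
    rw [ContinuousAt, Metric.tendsto_nhds]
    intro ε hε
    obtain ⟨δ, hδ, h⟩ := hK (e, e) (y t, y s) ε hε
    have h1 := ((hlim t).eventually_lt_const hδ).prod_nhds ((hlim s).eventually_lt_const hδ)
    filter_upwards [h1] with x hx
    have := h (e, e) (y x.1, y x.2) (by simpa [e, hself] using hδ) (by simpa [e, hself] using hδ)
      hx.1 hx.2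
    rwa [he, he] at this
  rw [continuousOn_iff_continuous_domRestrict]
  let φ : (Set.Icc (-1 : ℝ) 1 ×ˢ Set.Icc (-1 : ℝ) 1 : Set (ℝ × ℝ)) →
      Set.Icc (-1 : ℝ) 1 × Set.Icc (-1 : ℝ) 1 := fun x => (⟨x.1.1, x.2.1⟩, ⟨x.1.2, x.2.2⟩)
  have hφ : Continuous φ := by fun_prop
  exact key.comp hφ

/-! ### Schur products and the converse -/

theorem posSemidef_pow_hadamard {n : ℕ} {M N : Matrix (Fin n) (Fin n) ℝ} (hM : M.PosSemidef)
    (hN : N.PosSemidef) (k l : ℕ) :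
    (Matrix.of fun i j => M i j ^ k * N i j ^ l : Matrix (Fin n) (Fin n) ℝ).PosSemidef := by
  have hpow : ∀ {M : Matrix (Fin n) (Fin n) ℝ}, M.PosSemidef → ∀ k : ℕ,
      (Matrix.of fun i j => M i j ^ k : Matrix (Fin n) (Fin n) ℝ).PosSemidef := by
    intro M hM k
    induction k with
    | zero =>
      have h := Matrix.posSemidef_gram ℝ (fun _ : Fin n => (1 : ℝ))
      rw [show (Matrix.of fun i j => M i j ^ 0) = Matrix.gram ℝ fun _ : Fin n => (1 : ℝ) by
        ext i j; simp [Matrix.gram_apply]]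
      exact h
    | succ k ih =>
      rw [show (Matrix.of fun i j => M i j ^ (k + 1)) =
        (Matrix.of fun i j => M i j ^ k).hadamard M by ext i j; simp [pow_succ]]
      exact ih.hadamard hM
  exact (hpow hM k).hadamard (hpow hN l)

theorem sum_dot_pow_nonneg {n : ℕ} (x z : Fin n → HilbertSphere) (c : Fin n → ℝ) (k l : ℕ) :
    0 ≤ ∑ i, ∑ j, c i * c j *
      (HilbertSphere.dot (x i) (x j) ^ k * HilbertSphere.dot (z i) (z j) ^ l) := by
  have h := (posSemidef_pow_hadamard
    (Matrix.posSemidef_gram ℝ fun i => (x i : lp (fun _ : ℕ => ℝ) 2))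
    (Matrix.posSemidef_gram ℝ fun i => (z i : lp (fun _ : ℕ => ℝ) 2)) k l).dotProduct_mulVec_nonneg
      c
  refine h.trans_eq (Eq.symm ?_)
  simp only [dotProduct, Matrix.mulVec, mul_sum, Matrix.of_apply, Matrix.gram_apply, Pi.star_apply,
    HilbertSphere.dot, star_trivial]
  refine sum_congr rfl fun i _ => sum_congr rfl fun j _ => by ring

theorem HilbertSphere.dot_mem_Icc (x y : HilbertSphere) : dot x y ∈ Set.Icc (-1 : ℝ) 1 := by
  have h := abs_real_inner_le_norm (x : lp (fun _ : ℕ => ℝ) 2) (y : lp (fun _ : ℕ => ℝ) 2)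
  rw [norm_eq_of_mem_sphere, norm_eq_of_mem_sphere, one_mul] at h
  exact abs_le.mp h

theorem mainTheorem3
    (K : HilbertSphere × HilbertSphere → HilbertSphere × HilbertSphere → ℝ)
    (hK : IsContinuousKernel K)
    (f : ℝ → ℝ → ℝ) (hf : IsIsotropicPart K f) :
    IsPositiveDefiniteKernel K ↔
      ∃ a : ℕ → ℕ → ℝ, (∀ k l, 0 ≤ a k l) ∧
        Summable (fun p : ℕ × ℕ => a p.1 p.2) ∧
        ∀ t ∈ Set.Icc (-1 : ℝ) 1, ∀ s ∈ Set.Icc (-1 : ℝ) 1,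
          HasSum (fun p : ℕ × ℕ => a p.1 p.2 * t ^ p.1 * s ^ p.2) (f t s) := by
  constructor
  · intro hpd
    have hF := continuousOn_isotropicPart hK hf
    obtain ⟨a, ha, hsum, h⟩ := hasSum_limit_of_nonneg_coeff hF
      -- The shift to `n + 1` avoids `d = 0`, where there is no inscribed cube.
      (b := fun n => signBernsteinCoeff (n + 1) f) (P := fun n => signBernstein (n + 1) f)
      (fun n p => Finset.sum_nonneg fun q _ =>
        mul_nonneg (by positivity) (sum_signChar_nonneg hf hpd q.1 q.2))
      (fun n t s => hasSum_signBernstein (n + 1) f t s)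
      (fun t ht s hs => (tendsto_add_atTop_iff_nat 1).mpr (tendsto_signBernstein hF ht hs))
    exact ⟨fun k l => a (k, l), fun k l => ha (k, l), hsum, h⟩
  · rintro ⟨a, ha, -, h⟩ n - p - c
    have hterm : ∀ i j, HasSum (fun q : ℕ × ℕ => c i * c j *
        (a q.1 q.2 * HilbertSphere.dot (p i).1 (p j).1 ^ q.1 *
          HilbertSphere.dot (p i).2 (p j).2 ^ q.2)) (c i * c j * K (p i) (p j)) := fun i j => by
      rw [hf (p i).1 (p j).1 (p i).2 (p j).2]
      exact (h _ (HilbertSphere.dot_mem_Icc _ _) _ (HilbertSphere.dot_mem_Icc _ _)).mul_left _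
    refine (hasSum_sum fun i _ => hasSum_sum fun j _ => hterm i j).nonneg fun q => ?_
    have hq := mul_nonneg (ha q.1 q.2)
      (sum_dot_pow_nonneg (fun i => (p i).1) (fun i => (p i).2) c q.1 q.2)
    convert hq using 1
    simp only [mul_sum]
    exact sum_congr rfl fun i _ => sum_congr rfl fun j _ => by ring
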